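/- Theorem B. For a finite group $G$ let $k'(G)$ be the number of conjugacy classes of subgroups of $G$, let $L(G)$ be the subgroup lattice of $G$, and put $d'(G)=\frac{k'(G)}{|L(G)|}$. Let $d^*(G)$ be the minimum of $d'(S)$ over all sections $S=H/K$ of $G$ (where $H\le G$ and $K\trianglelefteq H$). A modular $p$-group ($p$ a prime) is a $p$-group whose subgroup lattice is modular. Then $d^*(S_3)=d'(S_3)=\frac{2}{3}$. Let $G$ be a finite group with $d^*(G)>\frac{2}{3}$. Then $G$ is nilpotent. If moreover $2\nmid |G|$, then $G$ is isomorphic to a direct product $P_1\times\cdots\times P_k$ (with $k\ge 0$) in which each $P_i$ is a subgroup of $G$ that is a modular $p_i$-group, and $p_1,\dots,p_k$ are pairwise distinct primes. -/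

import Mathlib

/-- The number `k'(G)` of conjugacy classes of subgroups of `G`: the number of orbits of `G`
acting on its subgroups by conjugation. -/
noncomputable def numSubgroupClasses (G : Type*) [Group G] : ℕ :=
  letI : MulAction (ConjAct G) (Subgroup G) := Subgroup.pointwiseMulAction
  Nat.card (MulAction.orbitRel.Quotient (ConjAct G) (Subgroup G))

/-- The ratio `d'(G) = k'(G) / |L(G)|`, where `L(G)` is the subgroup lattice of `G`. -/
noncomputable def dPrime (G : Type*) [Group G] : ℝ :=
  (numSubgroupClasses G : ℝ) / (Nat.card (Subgroup G) : ℝ)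

/-- The set of all values `d'(S)`, where `S = H ⧸ K` (with `H ≤ G` and `K` normal in `H`)
is a section of `G`. -/
def sectionValues (G : Type*) [Group G] : Set ℝ :=
  {x | ∃ (H : Subgroup G) (K : Subgroup H) (_ : K.Normal), x = dPrime (H ⧸ K)}

/-- `d*(G)`, the minimum of `d'(S)` over all sections `S` of the finite group `G`
(the infimum is attained, see `isLeast_dStar`). -/
noncomputable def dStar (G : Type*) [Group G] : ℝ :=
  sInf (sectionValues G)

/-- For a finite group, `d*(G)` is indeed a minimum. -/
theorem isLeast_dStar (G : Type*) [Group G] [Finite G] :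
    IsLeast (sectionValues G) (dStar G) := by
  have hfin : (sectionValues G).Finite := by
    have hsub : sectionValues G ⊆ Set.range
        (fun S : (Σ H : Subgroup G, {K : Subgroup H // K.Normal}) =>
          haveI := S.2.2
          dPrime (S.1 ⧸ S.2.1)) := by
      rintro x ⟨H, K, hK, rfl⟩
      exact ⟨⟨H, ⟨K, hK⟩⟩, rfl⟩
    exact (Set.finite_range _).subset hsub
  have hne : (sectionValues G).Nonempty := ⟨_, ⊤, ⊥, inferInstance, rfl⟩
  exact ⟨hne.csInf_mem hfin, fun x hx => csInf_le hfin.bddBelow hx⟩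

/-- A modular `p`-group: a `p`-group (`p` prime) whose subgroup lattice is modular. -/
def IsModularPGroup (p : ℕ) (P : Type*) [Group P] : Prop :=
  p.Prime ∧ IsPGroup p P ∧ IsModularLattice (Subgroup P)

/-!
Why the theorem holds. The conjugacy classes of subgroups partition `L(G)`, so
`3 k'(G) ≤ 2 |L(G)|` as soon as the sum of `2 c - 3` over the class sizes `c` is nonnegative. Only
the normal subgroups contribute negatively, with `-1` each, while a class of size at least `3`
contributes at least `3`. Hence `d'(G) ≤ 2/3` if there are at most three times as many normal
subgroups as classes of size at least `3` (`dPrime_le_two_thirds`). Since `d*` does not decrease on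
passing to a section, both assertions reduce to minimal situations where this criterion applies.

Nilpotency: a non-nilpotent group all of whose proper sections are nilpotent is simple or a
semidirect product `N ⋊ ⟨x⟩` with `N` abelian and minimal normal and `x` of prime order. Either way
it has at most three normal subgroups (`eq_of_normal_of_minimal_not_isNilpotent`), and a nonnormal
maximal subgroup has at least three conjugates.

Modularity, for a `p`-group with `p` odd: let `D` be covered by both `A` and `B`. Then `D` is normal
in `⟨A, B⟩`, and `⟨A, B⟩ / D` is generated by two elements of order `p`. If it were not abelian, a
smallest nonabelian quotient would be the group of order `p³` and exponent `p`, in which each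
of the `p + 1` subgroups of order `p²` contributes its own class of `p` nonnormal subgroups of
order `p`, so that the criterion applies (`dPrime_le_of_minimal_not_comm`). So
`|⟨A, B⟩| |D| ≤ |A| |B|` for covering pairs. This inequality propagates to all `A, B ≥ D`
(`card_sup_mul_card_le_of_covBy`), and with `D = A ∩ B` it forces the modular law
(`isModularLattice_of_card_sup_mul_card_le`). A finite nilpotent group is the product of its Sylow
subgroups, which gives the decomposition.
-/

open scoped Pointwise

/-! ### Invariance of `d'` and monotonicity of `d*` -/

section Sections

variable {G : Type*} [Group G]

theorem orbitRel_conjAct_subgroup_iff {H K : Subgroup G} :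
    MulAction.orbitRel (ConjAct G) (Subgroup G) H K ↔ ∃ g : G, MulAut.conj g • K = H := by
  rw [MulAction.orbitRel_apply]
  exact Iff.rfl

theorem map_conj_smul {G' : Type*} [Group G'] (f : G →* G') (g : G) (H : Subgroup G) :
    (MulAut.conj g • H).map f = MulAut.conj (f g) • H.map f := by
  ext x
  simp only [Subgroup.mem_map, Subgroup.mem_smul_pointwise_iff_exists, MulAut.smul_def,
    MulAut.conj_apply]
  constructor
  · rintro ⟨_, ⟨h, hh, rfl⟩, rfl⟩
    exact ⟨f h, ⟨h, hh, rfl⟩, by simp⟩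
  · rintro ⟨_, ⟨h, hh, rfl⟩, rfl⟩
    exact ⟨g * h * g⁻¹, ⟨h, hh, rfl⟩, by simp⟩

theorem dPrime_congr {G' : Type*} [Group G'] (e : G ≃* G') : dPrime G = dPrime G' := by
  have h1 : Nat.card (Subgroup G) = Nat.card (Subgroup G') :=
    Nat.card_congr e.mapSubgroup.toEquiv
  have h2 : numSubgroupClasses G = numSubgroupClasses G' := by
    unfold numSubgroupClasses
    refine Nat.card_congr (Quotient.congr e.mapSubgroup.toEquiv fun H K => ?_)
    refine orbitRel_conjAct_subgroup_iff.trans (Iff.trans ?_ orbitRel_conjAct_subgroup_iff.symm)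
    change (∃ g : G, MulAut.conj g • K = H) ↔
      ∃ g : G', MulAut.conj g • K.map e.toMonoidHom = H.map e.toMonoidHom
    refine Iff.trans ?_ (e.surjective.exists (p := fun g =>
      MulAut.conj g • K.map e.toMonoidHom = H.map e.toMonoidHom)).symm
    refine exists_congr fun g => ?_
    rw [← (Subgroup.map_injective (f := e.toMonoidHom) e.injective).eq_iff (a := MulAut.conj g • K)]
    exact Eq.congr_left (map_conj_smul e.toMonoidHom g K)
  rw [dPrime, dPrime, h1, h2]

variable [Finite G]

/-- `d*(G)` bounds `d'` of every section, presented as the image under a surjection `f` of a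
group `A` embedded in `G`. -/
theorem dStar_le_dPrime {A S : Type*} [Group A] [Group S] (i : A →* G)
    (hi : Function.Injective i) (f : A →* S) (hf : Function.Surjective f) :
    dStar G ≤ dPrime S := by
  let e : A ≃* i.range := MonoidHom.ofInjective hi
  let f' : i.range →* S := f.comp e.symm.toMonoidHom
  have hf' : Function.Surjective f' := hf.comp e.symm.surjective
  rw [← dPrime_congr (QuotientGroup.quotientKerEquivOfSurjective f' hf')]
  exact (isLeast_dStar G).2 ⟨i.range, f'.ker, inferInstance, rfl⟩

theorem dStar_le_dPrime_self : dStar G ≤ dPrime G :=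
  dStar_le_dPrime (MonoidHom.id G) Function.injective_id (MonoidHom.id G) Function.surjective_id

theorem dStar_le_dStar_of_injective {A : Type*} [Group A] (i : A →* G)
    (hi : Function.Injective i) : dStar G ≤ dStar A := by
  have : Finite A := Finite.of_injective i hi
  obtain ⟨H, K, hK, h⟩ := (isLeast_dStar A).1
  rw [h]
  exact dStar_le_dPrime (i.comp H.subtype) (hi.comp H.subtype_injective)
    (QuotientGroup.mk' K) (QuotientGroup.mk'_surjective K)

theorem dStar_le_dStar_of_surjective {S : Type*} [Group S] (f : G →* S)
    (hf : Function.Surjective f) : dStar G ≤ dStar S := by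
  have : Finite S := Finite.of_surjective f hf
  obtain ⟨H, K, hK, h⟩ := (isLeast_dStar S).1
  rw [h]
  exact dStar_le_dPrime (H.comap f).subtype (H.comap f).subtype_injective
    ((QuotientGroup.mk' K).comp (f.subgroupComap H))
    ((QuotientGroup.mk'_surjective K).comp (f.subgroupComap_surjective_of_surjective H hf))

theorem dPrime_eq_one_of_comm (h : ∀ a b : G, a * b = b * a) : dPrime G = 1 := by
  have h2 : numSubgroupClasses G = Nat.card (Subgroup G) := by
    unfold numSubgroupClasses
    refine (Nat.card_congr (Equiv.ofBijective (Quotient.mk _) ⟨fun H K hHK => ?_,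
      Quotient.mk_surjective⟩)).symm
    obtain ⟨g, hg⟩ := orbitRel_conjAct_subgroup_iff.1 (Quotient.exact hHK)
    have hK : K.Normal := ⟨fun n hn g => by rwa [h g n, mul_inv_cancel_right]⟩
    rw [← hg, Subgroup.Normal.conj_smul_eq_self]
  rw [dPrime, h2, div_self]
  exact_mod_cast Nat.card_pos.ne'

end Sections

/-! ### A counting criterion for `d'(G) ≤ 2/3` -/

section Criterion

variable {G : Type*} [Group G]

theorem card_conj_orbit (H : Subgroup G) :
    Nat.card (MulAction.orbit (ConjAct G) H) = (Subgroup.normalizer (H : Set G)).index := by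
  have : Nat.card (MulAction.orbit (ConjAct G) H)
      = (MulAction.stabilizer (ConjAct G) H).index := by
    rw [MulAction.index_stabilizer, Set.ncard, Nat.card_coe_set_eq, Set.ncard]
  rw [this, ← Subgroup.index_comap_of_surjective _
    (f := (ConjAct.toConjAct (G := G)).toMonoidHom) ConjAct.toConjAct.surjective]
  congr 1
  ext g
  exact Subgroup.conjAct_pointwise_smul_iff

variable [Finite G]

/-- If `T` is a set of pairwise non-conjugate subgroups, each with at least three conjugates, and
there are at most `3 |T|` normal subgroups, then `d'(G) ≤ 2/3`. -/
theorem dPrime_le_two_thirds (T : Finset (Subgroup G))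
    (hT : ∀ H ∈ T, 3 ≤ (Subgroup.normalizer (H : Set G)).index)
    (hconj : ∀ H ∈ T, ∀ K ∈ T, ∀ g : G, MulAut.conj g • K = H → H = K)
    (hN : Nat.card {H : Subgroup G // H.Normal} ≤ 3 * T.card) :
    dPrime G ≤ 2 / 3 := by
  classical
  let Q := MulAction.orbitRel.Quotient (ConjAct G) (Subgroup G)
  have := Fintype.ofFinite Q
  let o : Q → ℕ := fun q => Nat.card q.orbit
  have ho : ∀ H : Subgroup G, o (Quotient.mk _ H) = (Subgroup.normalizer (H : Set G)).index :=
    card_conj_orbit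
  have ho1 : ∀ q, 1 ≤ o q := by
    intro q
    induction q using Quotient.inductionOn with
    | h H => rw [ho]; exact Nat.pos_of_ne_zero Subgroup.index_ne_zero_of_finite
  have hL : Nat.card (Subgroup G) = ∑ q, o q := by
    rw [Nat.card_congr (MulAction.selfEquivSigmaOrbits' (ConjAct G) (Subgroup G)), Nat.card_sigma]
  have hk : numSubgroupClasses G = ∑ q : Q, 1 := by
    rw [Finset.sum_const, smul_eq_mul, mul_one, Finset.card_univ, ← Nat.card_eq_fintype_card]
    rfl
  let T' : Finset Q := T.image (Quotient.mk _)
  have hT'c : T'.card = T.card := by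
    refine Finset.card_image_of_injOn fun H hH K hK h => ?_
    obtain ⟨g, hg⟩ := orbitRel_conjAct_subgroup_iff.1 (Quotient.exact h)
    exact hconj H hH K hK g hg
  have hT' : ∀ q ∈ T', 3 ≤ o q := by
    intro q hq
    obtain ⟨H, hH, rfl⟩ := Finset.mem_image.1 hq
    rw [ho]; exact hT H hH
  let F : Finset Q := Finset.univ.filter (fun q => o q = 1)
  have hF : F.card ≤ Nat.card {H : Subgroup G // H.Normal} := by
    rw [← Nat.card_eq_finsetCard F]
    refine Nat.card_le_card_of_injective (fun q => ⟨q.1.out, ?_⟩) ?_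
    · have h1 : o q.1 = 1 := (Finset.mem_filter.1 q.2).2
      rw [← Quotient.out_eq q.1, ho, Subgroup.index_eq_one] at h1
      exact Subgroup.normalizer_eq_top_iff.1 h1
    · intro q r h
      exact Subtype.ext (Quotient.out_injective (Subtype.ext_iff.1 h))
  -- a class of size `c` satisfies `2 c ≥ 3` unless `c = 1`, and `2 c ≥ 6` if it meets `T`
  have key : ∑ q : Q, (3 * 1 + if q ∈ T' then 3 else 0) ≤
      ∑ q : Q, (2 * o q + if q ∈ F then 1 else 0) := by
    refine Finset.sum_le_sum fun q _ => ?_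
    have h1 := ho1 q
    by_cases hq : q ∈ T'
    · have := hT' q hq
      simp only [hq, if_true]; omega
    · by_cases hq' : o q = 1
      · have : q ∈ F := by simp [F, hq']
        simp only [hq, this, if_true, if_false]; omega
      · simp only [hq, if_false]; omega
  rw [Finset.sum_add_distrib, Finset.sum_add_distrib, ← Finset.mul_sum, ← Finset.mul_sum, ← hL,
    ← hk, Finset.sum_ite_mem, Finset.sum_ite_mem, Finset.univ_inter, Finset.univ_inter,
    Finset.sum_const, Finset.sum_const, hT'c] at key
  simp only [smul_eq_mul] at key
  have hpos : (0 : ℝ) < Nat.card (Subgroup G) := by exact_mod_cast Nat.card_pos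
  rw [dPrime, div_le_div_iff₀ hpos (by norm_num)]
  have : 3 * numSubgroupClasses G ≤ 2 * Nat.card (Subgroup G) := by omega
  have : (3 * numSubgroupClasses G : ℝ) ≤ 2 * Nat.card (Subgroup G) := by exact_mod_cast this
  linarith

/-- A nonnormal subgroup never has exactly one conjugate; two conjugates are excluded when
its normalizer is not of index `2`. -/
theorem three_le_index_normalizer {H : Subgroup G} (hH : ¬ H.Normal)
    (h2 : (Subgroup.normalizer (H : Set G)).index ≠ 2) :
    3 ≤ (Subgroup.normalizer (H : Set G)).index := by
  have h0 : (Subgroup.normalizer (H : Set G)).index ≠ 0 := Subgroup.index_ne_zero_of_finite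
  have h1 : (Subgroup.normalizer (H : Set G)).index ≠ 1 := fun h =>
    hH (Subgroup.normalizer_eq_top_iff.1 (Subgroup.index_eq_one.1 h))
  omega

end Criterion

/-! ### Nilpotency -/

section Nilpotency

variable {G : Type*} [Group G]

/-- A nontrivial normal subgroup of a nilpotent group meets the center nontrivially. -/
theorem inf_center_ne_bot_of_isNilpotent [Group.IsNilpotent G] (N : Subgroup G) [hN : N.Normal]
    (h : N ≠ ⊥) : N ⊓ Subgroup.center G ≠ ⊥ := by
  intro hc
  have key : ∀ n, N ⊓ Subgroup.upperCentralSeries G n = ⊥ := by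
    intro n
    induction n with
    | zero => simp
    | succ n ih =>
      rw [eq_bot_iff, ← hc]
      rintro x ⟨hxN, hx⟩
      refine ⟨hxN, Subgroup.mem_center_iff.2 fun g => ?_⟩
      have h1 : x * g * x⁻¹ * g⁻¹ ∈ N ⊓ Subgroup.upperCentralSeries G n := by
        refine ⟨?_, Subgroup.mem_upperCentralSeries_succ_iff.1 hx g⟩
        have := N.mul_mem hxN (hN.conj_mem _ (N.inv_mem hxN) g)
        simpa only [mul_assoc, SetLike.mem_coe, Subgroup.mem_toSubmonoid] using this
      rw [ih, Subgroup.mem_bot, mul_inv_eq_one, mul_inv_eq_iff_eq_mul] at h1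
      exact h1.symm
  obtain ⟨n, hn⟩ := Group.IsNilpotent.nilpotent G
  apply h
  rw [← key n, hn, inf_top_eq]

theorem le_normalizer_of_conj_mem {H C : Subgroup G}
    (h : ∀ g ∈ H, ∀ c ∈ C, g * c * g⁻¹ ∈ C) : H ≤ Subgroup.normalizer (C : Set G) := by
  intro g hg
  rw [Subgroup.mem_normalizer_iff]
  refine fun c => ⟨h g hg c, fun hc => ?_⟩
  have := h g⁻¹ (H.inv_mem hg) _ hc
  simpa [mul_assoc] using this

/-- A maximal subgroup containing a normal subgroup with nilpotent quotient is normal. -/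
theorem normal_of_isCoatom_of_le {H M : Subgroup G} [H.Normal] [Group.IsNilpotent (G ⧸ H)]
    (hM : IsCoatom M) (hHM : H ≤ M) : M.Normal := by
  have hcm : (M.map (QuotientGroup.mk' H)).comap (QuotientGroup.mk' H) = M := by
    rw [Subgroup.comap_map_eq_self]
    rwa [QuotientGroup.ker_mk']
  have hsurj := QuotientGroup.mk'_surjective H
  have hco : IsCoatom (M.map (QuotientGroup.mk' H)) := by
    refine ⟨fun h => hM.1 ?_, fun L hL => ?_⟩
    · rw [← hcm, h, Subgroup.comap_top]
    · have := hM.2 (L.comap (QuotientGroup.mk' H)) (by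
        conv_lhs => rw [← hcm]
        exact (Subgroup.comap_lt_comap_of_surjective hsurj).2 hL)
      rw [← Subgroup.map_comap_eq_self_of_surjective hsurj L, this,
        Subgroup.map_top_of_surjective _ hsurj]
  have := Subgroup.NormalizerCondition.normal_of_coatom _
    (Group.normalizerCondition_of_isNilpotent (G := G ⧸ H)) hco
  rw [← hcm]
  infer_instance

variable [Finite G]

theorem exists_isCoatom_not_normal (hG : ¬ Group.IsNilpotent G) :
    ∃ M : Subgroup G, IsCoatom M ∧ ¬ M.Normal := by
  by_contra! h
  exact hG ((Group.isNilpotent_of_finite_tfae.out 0 2 rfl rfl).2 h)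

/-- In a finite non-nilpotent group all of whose proper subgroups and proper quotients are
nilpotent, there is at most one normal subgroup other than `⊥` and `⊤`. If there is one, the group is
`N ⋊ ⟨x⟩` with `N` abelian and minimal normal, and `x` of prime order. -/
theorem eq_of_normal_of_minimal_not_isNilpotent (hG : ¬ Group.IsNilpotent G)
    (hsub : ∀ H : Subgroup G, H ≠ ⊤ → Group.IsNilpotent H)
    (hquo : ∀ (N : Subgroup G) [N.Normal], N ≠ ⊥ → Group.IsNilpotent (G ⧸ N))
    {A B : Subgroup G} [hA : A.Normal] [hB : B.Normal] (hA0 : A ≠ ⊥) (hA1 : A ≠ ⊤)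
    (hB0 : B ≠ ⊥) (hB1 : B ≠ ⊤) : A = B := by
  obtain ⟨M, hM, hMn⟩ := exists_isCoatom_not_normal hG
  have hnle : ∀ (H : Subgroup G) [H.Normal], H ≠ ⊥ → H ⊔ M = ⊤ := by
    intro H _ hH
    have := hquo H hH
    have hH' : ¬ H ≤ M := fun h => hMn (normal_of_isCoatom_of_le hM h)
    exact hM.2 _ (right_lt_sup.2 hH')
  have hcenter : Subgroup.center G = ⊥ := by
    by_contra h
    exact hG (Group.of_quotient_center_nilpotent (hquo _ h))
  -- a central element of prime order in `M`
  obtain ⟨x, hxM, hxq, hxc⟩ : ∃ x ∈ M, (orderOf x).Prime ∧ ∀ m ∈ M, m * x = x * m := by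
    have := hsub M hM.1
    have : Nontrivial M := (Subgroup.nontrivial_iff_ne_bot M).2 fun h => hMn (h ▸ inferInstance)
    have hz := Group.IsNilpotent.center_ne_bot (G := M)
    have hcard : Nat.card (Subgroup.center M) ≠ 1 := fun h =>
      hz (Subgroup.card_eq_one.1 h)
    obtain ⟨q, hq, hqd⟩ := Nat.exists_prime_and_dvd hcard
    have := Fact.mk hq
    obtain ⟨y, hy⟩ := exists_prime_orderOf_dvd_card' q hqd
    refine ⟨y.1.1, y.1.2, ?_, fun m hm => ?_⟩
    · rw [Subgroup.orderOf_coe, Subgroup.orderOf_coe, hy]; exact hq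
    · exact congrArg Subtype.val (Subgroup.mem_center_iff.1 y.2 ⟨m, hm⟩)
  have hx1 : x ≠ 1 := by
    rintro rfl
    rw [orderOf_one] at hxq
    exact Nat.not_prime_one hxq
  -- a minimal normal subgroup `N` below `A`
  obtain ⟨N, hNA, hN⟩ := exists_minimal_le_of_wellFoundedLT
    (fun H : Subgroup G => H.Normal ∧ H ≠ ⊥) A ⟨hA, hA0⟩
  have hNn : N.Normal := hN.prop.1
  have hN0 : N ≠ ⊥ := hN.prop.2
  have hN1 : N ≠ ⊤ := fun h => hA1 (top_le_iff.1 (h ▸ hNA))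
  have hmin : ∀ (K : Subgroup G) [K.Normal], K ≤ N → K ≠ ⊥ → K = N := fun K hK hKN hK0 =>
    le_antisymm hKN (hN.le_of_le ⟨hK, hK0⟩ hKN)
  have hNcomm : ∀ a ∈ N, ∀ b ∈ N, a * b = b * a := by
    have := hsub N hN1
    have : Nontrivial N := (Subgroup.nontrivial_iff_ne_bot N).2 hN0
    have hz := Group.IsNilpotent.center_ne_bot (G := N)
    have hzN : (Subgroup.center N).map N.subtype = N := by
      refine hmin _ (Subgroup.map_subtype_le _) fun h => hz ?_
      exact (Subgroup.map_eq_bot_iff_of_injective _ N.subtype_injective).1 h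
    intro a ha b hb
    rw [← hzN] at hb
    obtain ⟨b, hb, rfl⟩ := hb
    exact congrArg Subtype.val (Subgroup.mem_center_iff.1 hb ⟨a, ha⟩)
  have hNM : N ⊔ M = ⊤ := hnle N hN0
  -- `x` acts on `N` without nontrivial fixed points
  have hfix : ∀ n ∈ N, n * x = x * n → n = 1 := by
    let C : Subgroup G := N ⊓ Subgroup.centralizer {x}
    have hmemC : ∀ {c}, c ∈ C ↔ c ∈ N ∧ c * x = x * c := by
      intro c
      rw [Subgroup.mem_inf, Subgroup.mem_centralizer_singleton_iff]
    have hCn : C.Normal := by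
      rw [← Subgroup.normalizer_eq_top_iff, ← top_le_iff, ← hNM]
      refine sup_le (le_normalizer_of_conj_mem fun g hg c hc => ?_)
        (le_normalizer_of_conj_mem fun g hg c hc => ?_)
      · rwa [hNcomm g hg c (hmemC.1 hc).1, mul_inv_cancel_right]
      · refine hmemC.2 ⟨hNn.conj_mem c (hmemC.1 hc).1 g, ?_⟩
        have h1 : Commute g x := hxc g hg
        have h2 : Commute c x := (hmemC.1 hc).2
        exact (h1.mul_left h2).mul_left h1.inv_left
    have hC0 : C = ⊥ := by
      by_contra hC
      have hCN := hmin C inf_le_left hC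
      have hxz : x ∈ Subgroup.center G := by
        have : N ⊔ M ≤ Subgroup.centralizer {x} := by
          refine sup_le (hCN ▸ inf_le_right) fun m hm => ?_
          rw [Subgroup.mem_centralizer_singleton_iff]
          exact hxc m hm
        rw [hNM] at this
        exact Subgroup.mem_center_iff.2 fun g =>
          Subgroup.mem_centralizer_singleton_iff.1 (this (Subgroup.mem_top g))
      rw [hcenter] at hxz
      exact hx1 hxz
    intro n hn hnx
    have : n ∈ C := hmemC.2 ⟨hn, hnx⟩
    rwa [hC0] at this
  -- otherwise `N ⊔ ⟨x⟩` is nilpotent, so its center meets `N` and contains a fixed point of `x`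
  have hNx : N ⊔ Subgroup.zpowers x = ⊤ := by
    by_contra hJ
    have := hsub _ hJ
    have hN' : N.subgroupOf (N ⊔ Subgroup.zpowers x) ≠ ⊥ := by
      rw [Ne, Subgroup.subgroupOf_eq_bot, disjoint_iff, inf_eq_left.2 le_sup_left]
      exact hN0
    obtain ⟨⟨y, hyN, hyz⟩, hy1⟩ :=
      Subgroup.ne_bot_iff_exists_ne_one.1 (inf_center_ne_bot_of_isNilpotent _ hN')
    refine hy1 (Subtype.ext (Subtype.ext (hfix _ hyN ?_)))
    exact (congrArg Subtype.val (Subgroup.mem_center_iff.1 hyz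
      ⟨x, le_sup_right (a := N) (Subgroup.mem_zpowers x)⟩)).symm
  -- `G ⧸ N` has prime order, and `N` lies below every nontrivial normal subgroup
  have huniq : ∀ (K : Subgroup G) [K.Normal], K ≠ ⊥ → K ≠ ⊤ → K = N := by
    intro K hK hK0 hK1
    have hNK : N ≤ K := by
      by_contra hle
      have hinf : K ⊓ N = ⊥ := by
        by_contra h
        exact hle (inf_eq_right.1 (hmin (K ⊓ N) inf_le_right h))
      have h1 := hquo K hK0
      have h2 := hquo N hN0
      refine hG (Subgroup.isNilpotent_of_ker_le_center
        ((QuotientGroup.mk' K).prod (QuotientGroup.mk' N)) ?_)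
      rw [MonoidHom.ker_prod, QuotientGroup.ker_mk', QuotientGroup.ker_mk', hinf]
      exact bot_le
    refine le_antisymm (fun b hb => ?_) hNK
    by_contra hbN
    have hbt : b ∈ N ⊔ Subgroup.zpowers x := hNx ▸ Subgroup.mem_top b
    rw [Subgroup.mem_sup_of_normal_left] at hbt
    obtain ⟨n, hn, z, hz, rfl⟩ := hbt
    have hzK : z ∈ K := (K.mul_mem_cancel_left (hNK hn)).1 hb
    have hz1 : z ≠ 1 := by rintro rfl; exact hbN (by simpa using hn)
    have := Fact.mk (show (Nat.card (Subgroup.zpowers x)).Prime by rwa [Nat.card_zpowers])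
    rcases (K.subgroupOf (Subgroup.zpowers x)).eq_bot_or_eq_top_of_prime_card with h | h
    · have : (⟨z, hz⟩ : Subgroup.zpowers x) ∈ K.subgroupOf (Subgroup.zpowers x) := hzK
      rw [h, Subgroup.mem_bot] at this
      exact hz1 (congrArg Subtype.val this)
    · rw [Subgroup.subgroupOf_eq_top] at h
      exact hK1 (top_le_iff.1 (hNx ▸ sup_le hNK h))
  rw [huniq A hA0 hA1, huniq B hB0 hB1]

/-- There are at most three normal subgroups, and a nonnormal maximal subgroup, which is its own
normalizer, has at least three conjugates. -/
theorem dPrime_le_of_minimal_not_isNilpotent (hG : ¬ Group.IsNilpotent G)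
    (hsub : ∀ H : Subgroup G, H ≠ ⊤ → Group.IsNilpotent H)
    (hquo : ∀ (N : Subgroup G) [N.Normal], N ≠ ⊥ → Group.IsNilpotent (G ⧸ N)) :
    dPrime G ≤ 2 / 3 := by
  classical
  obtain ⟨M, hM, hMn⟩ := exists_isCoatom_not_normal hG
  have hnorm : Subgroup.normalizer (M : Set G) = M := by
    by_contra h
    exact hMn (Subgroup.normalizer_eq_top_iff.1
      (hM.2 _ (lt_of_le_of_ne Subgroup.le_normalizer (Ne.symm h))))
  obtain ⟨A, hA⟩ : ∃ A : Subgroup G, ∀ H : Subgroup G, H.Normal → H = ⊥ ∨ H = A ∨ H = ⊤ := by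
    by_cases h : ∃ A : Subgroup G, A.Normal ∧ A ≠ ⊥ ∧ A ≠ ⊤
    · obtain ⟨A, hAn, hA0, hA1⟩ := h
      refine ⟨A, fun H hH => ?_⟩
      by_cases hH0 : H = ⊥
      · exact Or.inl hH0
      by_cases hH1 : H = ⊤
      · exact Or.inr (Or.inr hH1)
      exact Or.inr (Or.inl
        (eq_of_normal_of_minimal_not_isNilpotent hG hsub hquo hH0 hH1 hA0 hA1))
    -- if `G` is simple, any value serves as `A`
    · push Not at h
      refine ⟨⊥, fun H hH => ?_⟩
      by_cases hH0 : H = ⊥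
      · exact Or.inl hH0
      · exact Or.inr (Or.inr (h H hH hH0))
  refine dPrime_le_two_thirds {M} (fun H hH => ?_) (fun H hH K hK _ _ => ?_) ?_
  · rw [Finset.mem_singleton] at hH
    subst hH
    refine three_le_index_normalizer hMn fun h2 => hMn ?_
    rw [hnorm] at h2
    exact Subgroup.normal_of_index_eq_two h2
  · rw [Finset.mem_singleton.1 hH, Finset.mem_singleton.1 hK]
  · rw [Finset.card_singleton]
    have : Nat.card {H : Subgroup G // H.Normal} ≤
        Nat.card (({⊥, A, ⊤} : Finset (Subgroup G)) : Set (Subgroup G)) := by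
      refine Nat.card_mono (Finset.finite_toSet _) fun H hH => ?_
      simpa using hA H hH
    refine this.trans ?_
    rw [Nat.card_coe_set_eq, Set.ncard_coe_finset]
    exact Finset.card_le_three

theorem isNilpotent_of_two_thirds_lt_dStar (h : 2 / 3 < dStar G) : Group.IsNilpotent G := by
  induction hn : Nat.card G using Nat.strong_induction_on generalizing G with
  | _ n ih =>
    subst hn
    by_contra hG
    refine absurd (h.trans_le dStar_le_dPrime_self)
      (not_lt.2 (dPrime_le_of_minimal_not_isNilpotent hG (fun H hH => ?_) fun N _ hN => ?_))
    · refine ih _ ?_ (h.trans_le (dStar_le_dStar_of_injective H.subtype H.subtype_injective)) rfl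
      exact lt_of_le_of_ne H.card_le_card_group fun hc => hH (H.eq_top_of_card_eq hc)
    · refine ih _ ?_ (h.trans_le (dStar_le_dStar_of_surjective _
        (QuotientGroup.mk'_surjective N))) rfl
      rw [N.card_eq_card_quotient_mul_card_subgroup]
      exact lt_mul_of_one_lt_right Nat.card_pos ((Subgroup.one_lt_card_iff_ne_bot N).2 hN)

end Nilpotency

/-! ### The symmetric group `S₃` -/

section SymmetricGroupThree

/-- The elements of a subset of `S₃` form a subgroup; a decidable reformulation, through which the
subgroups of `S₃` can be enumerated. -/
abbrev IsSubgroupFinset (s : Finset (Equiv.Perm (Fin 3))) : Prop :=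
  (∀ a ∈ s, ∀ b ∈ s, a * b ∈ s) ∧ 1 ∈ s ∧ ∀ a ∈ s, a⁻¹ ∈ s

theorem card_isSubgroupFinset : (Finset.univ.filter IsSubgroupFinset).card = 6 := by
  decide +kernel

theorem image_card_isSubgroupFinset :
    ((Finset.univ.filter IsSubgroupFinset).image Finset.card).card = 4 := by
  decide +kernel

theorem exists_conj_of_isSubgroupFinset :
    ∀ s ∈ Finset.univ.filter IsSubgroupFinset, ∀ t ∈ Finset.univ.filter IsSubgroupFinset,
      s.card = t.card → ∃ g : Equiv.Perm (Fin 3), ∀ x ∈ s, g * x * g⁻¹ ∈ t := by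
  decide +kernel

open Classical in
/-- The subgroups of `S₃` as finsets. -/
noncomputable def subgroupPermEquiv :
    Subgroup (Equiv.Perm (Fin 3)) ≃ Finset.univ.filter IsSubgroupFinset where
  toFun H := ⟨Finset.univ.filter (· ∈ H), by
    simp only [Finset.mem_filter, Finset.mem_univ, true_and, IsSubgroupFinset]
    exact ⟨fun a ha b hb => H.mul_mem ha hb, H.one_mem, fun a ha => H.inv_mem ha⟩⟩
  invFun s :=
    { carrier := s.1
      mul_mem' := fun {a b} ha hb => (Finset.mem_filter.1 s.2).2.1 a ha b hb
      one_mem' := (Finset.mem_filter.1 s.2).2.2.1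
      inv_mem' := fun {a} ha => (Finset.mem_filter.1 s.2).2.2.2 a ha }
  left_inv H := by
    ext x
    rw [← Subgroup.mem_carrier]
    simp
  right_inv s := by
    refine Subtype.ext (Finset.ext fun x => ?_)
    rw [Finset.mem_filter, ← Subgroup.mem_carrier]
    simp

theorem mem_subgroupPermEquiv {H : Subgroup (Equiv.Perm (Fin 3))} {x : Equiv.Perm (Fin 3)} :
    x ∈ (subgroupPermEquiv H).1 ↔ x ∈ H := by
  simp [subgroupPermEquiv]

theorem card_subgroupPermEquiv (H : Subgroup (Equiv.Perm (Fin 3))) :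
    (subgroupPermEquiv H).1.card = Nat.card H := by
  rw [← Nat.card_eq_finsetCard]
  exact Nat.card_congr (Equiv.subtypeEquivRight fun x => mem_subgroupPermEquiv)

theorem card_subgroup_perm : Nat.card (Subgroup (Equiv.Perm (Fin 3))) = 6 := by
  rw [Nat.card_congr subgroupPermEquiv, Nat.card_eq_finsetCard, card_isSubgroupFinset]

theorem card_conj_smul {G : Type*} [Group G] (g : G) (H : Subgroup G) :
    Nat.card (MulAut.conj g • H : Subgroup G) = Nat.card H :=
  (Nat.card_congr (Subgroup.equivSMul (MulAut.conj g) H).toEquiv).symm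

/-- Two subgroups of `S₃` are conjugate if and only if they have the same order, so the conjugacy
classes are counted by the possible orders. -/
theorem numSubgroupClasses_perm : numSubgroupClasses (Equiv.Perm (Fin 3)) = 4 := by
  have hcard : ∀ H K : Subgroup (Equiv.Perm (Fin 3)),
      MulAction.orbitRel (ConjAct (Equiv.Perm (Fin 3))) _ H K ↔ Nat.card H = Nat.card K := by
    intro H K
    rw [orbitRel_conjAct_subgroup_iff]
    constructor
    · rintro ⟨g, rfl⟩
      exact card_conj_smul g K
    · intro h
      obtain ⟨g, hg⟩ := exists_conj_of_isSubgroupFinset _ (subgroupPermEquiv K).2 _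
        (subgroupPermEquiv H).2 (by rw [card_subgroupPermEquiv, card_subgroupPermEquiv, h])
      refine ⟨g, Subgroup.eq_of_le_of_card_ge (fun x hx => ?_) ?_⟩
      · rw [Subgroup.mem_smul_pointwise_iff_exists] at hx
        obtain ⟨y, hy, rfl⟩ := hx
        exact mem_subgroupPermEquiv.1 (hg y (mem_subgroupPermEquiv.2 hy))
      · rw [card_conj_smul, h]
  unfold numSubgroupClasses
  let f : Subgroup (Equiv.Perm (Fin 3)) → ℕ := fun H => Nat.card H
  have h1 : MulAction.orbitRel (ConjAct (Equiv.Perm (Fin 3))) (Subgroup (Equiv.Perm (Fin 3)))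
      = Setoid.ker f := Setoid.ext fun H K => hcard H K
  have h2 : Set.range f = ((Finset.univ.filter IsSubgroupFinset).image Finset.card : Finset ℕ) := by
    have : f = (fun s => s.1.card) ∘ subgroupPermEquiv :=
      funext fun H => (card_subgroupPermEquiv H).symm
    rw [this, subgroupPermEquiv.surjective.range_comp, Finset.coe_image]
    ext n
    simp [-Finset.mem_filter, -Finset.coe_filter]
  change Nat.card (Quotient _) = 4
  rw [h1, Nat.card_congr (Setoid.quotientKerEquivRange f), h2, Nat.card_coe_set_eq, Set.ncard_coe_finset,
    image_card_isSubgroupFinset]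

theorem dPrime_perm : dPrime (Equiv.Perm (Fin 3)) = 2 / 3 := by
  rw [dPrime, numSubgroupClasses_perm, card_subgroup_perm]
  norm_num

theorem dStar_perm : dStar (Equiv.Perm (Fin 3)) = 2 / 3 := by
  have hc6 : Nat.card (Equiv.Perm (Fin 3)) = 6 := by
    rw [Nat.card_eq_fintype_card, Fintype.card_perm, Fintype.card_fin]
    rfl
  refine le_antisymm (dPrime_perm ▸ dStar_le_dPrime_self) ?_
  obtain ⟨H, K, hK, h⟩ := (isLeast_dStar (Equiv.Perm (Fin 3))).1
  rw [h]
  by_cases h6 : Nat.card (H ⧸ K) = 6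
  -- a section of order `6` is `S₃` itself
  · have hHK := K.card_eq_card_quotient_mul_card_subgroup
    have hH := H.card_subgroup_dvd_card
    rw [hc6, hHK, h6] at hH
    have hK1 : Nat.card K = 1 := Nat.dvd_one.1 (Nat.dvd_of_mul_dvd_mul_left (k := 6) (by norm_num)
      (by simpa using hH))
    rw [hK1, h6, mul_one, ← hc6] at hHK
    have hH' := H.eq_top_of_card_eq hHK
    have hK' := Subgroup.card_eq_one.1 hK1
    subst hH' hK'
    rw [dPrime_congr (QuotientGroup.quotientBot.trans Subgroup.topEquiv), dPrime_perm]
  · have hdvd : Nat.card (H ⧸ K) ∣ 6 := by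
      rw [← hc6]
      exact (Subgroup.card_quotient_dvd_card K).trans H.card_subgroup_dvd_card
    have hcomm : ∀ a b : H ⧸ K, a * b = b * a := by
      -- a group of order `1`, `2` or `3` is cyclic
      have : IsCyclic (H ⧸ K) := by
        have : Nat.card (H ⧸ K) ≤ 6 := Nat.le_of_dvd (by norm_num) hdvd
        have h123 : Nat.card (H ⧸ K) = 1 ∨ Nat.card (H ⧸ K) = 2 ∨ Nat.card (H ⧸ K) = 3 := by
          generalize Nat.card (H ⧸ K) = n at *
          interval_cases n <;> simp_all
        rcases h123 with h | h | h
        · have := (Nat.card_eq_one_iff_unique.1 h).1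
          infer_instance
        · have := Fact.mk Nat.prime_two
          exact isCyclic_of_prime_card h
        · have := Fact.mk Nat.prime_three
          exact isCyclic_of_prime_card h
      intro a b
      exact (IsCyclic.commGroup (α := H ⧸ K)).mul_comm a b
    rw [dPrime_eq_one_of_comm hcomm]
    norm_num

end SymmetricGroupThree

/-! ### `p`-groups generated by two elements of order `p` -/

section TwoGenerated

variable {G : Type*} [Group G]

theorem comm_of_closure_pair {a b : G} (h : Subgroup.closure {a, b} = ⊤) (hab : a * b = b * a)
    (x y : G) : x * y = y * x := by
  have hz : Subgroup.closure {a, b} ≤ Subgroup.center G := by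
    have key : ∀ u ∈ ({a, b} : Set G), u ∈ Subgroup.center G := by
      intro u hu
      have : Subgroup.closure {a, b} ≤ Subgroup.centralizer {u} := by
        rw [Subgroup.closure_le]
        rintro v hv
        rw [SetLike.mem_coe, Subgroup.mem_centralizer_singleton_iff]
        rcases hu with rfl | rfl <;> rcases hv with rfl | rfl <;> simp [hab]
      rw [h] at this
      exact Subgroup.mem_center_iff.2 fun g =>
        Subgroup.mem_centralizer_singleton_iff.1 (this (Subgroup.mem_top g))
    exact (Subgroup.closure_le _).2 key
  rw [h] at hz
  exact Subgroup.mem_center_iff.1 (hz (Subgroup.mem_top y)) x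

/-- The power formula for two elements whose commutator `c` commutes with both. -/
theorem mul_pow_of_commutator {x y c : G} (h : y * x = x * y * c) (hx : Commute c x)
    (hy : Commute c y) (n : ℕ) : (x * y) ^ n = x ^ n * y ^ n * c ^ n.choose 2 := by
  have hyn : ∀ n : ℕ, y ^ n * x = x * y ^ n * c ^ n := by
    intro n
    induction n with
    | zero => simp
    | succ n ih =>
      calc y ^ (n + 1) * x = y ^ n * (y * x) := by rw [pow_succ, mul_assoc]
        _ = (y ^ n * x) * y * c := by rw [h]; simp only [mul_assoc]
        _ = x * y ^ n * (c ^ n * y) * c := by rw [ih]; simp only [mul_assoc]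
        _ = x * y ^ (n + 1) * c ^ (n + 1) := by
          rw [(hy.pow_left n).eq, pow_succ, pow_succ]; simp only [mul_assoc]
  induction n with
  | zero => simp
  | succ n ih =>
    calc (x * y) ^ (n + 1) = x ^ n * y ^ n * (c ^ n.choose 2 * (x * y)) := by
          rw [pow_succ, ih]; simp only [mul_assoc]
      _ = x ^ n * (y ^ n * x) * y * c ^ n.choose 2 := by
          rw [((hx.mul_right hy).pow_left _).eq]; simp only [mul_assoc]
      _ = x ^ n * x * y ^ n * (c ^ n * y) * c ^ n.choose 2 := by
          rw [hyn]; simp only [mul_assoc]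
      _ = x ^ (n + 1) * y ^ (n + 1) * (c ^ n * c ^ n.choose 2) := by
          rw [(hy.pow_left n).eq, pow_succ, pow_succ]; simp only [mul_assoc]
      _ = _ := by
          rw [← pow_add, Nat.choose_succ_succ' n 1, Nat.choose_one_right]

theorem card_sup_le_of_normal [Finite G] (H N : Subgroup G) [N.Normal] :
    Nat.card (H ⊔ N : Subgroup G) ≤ Nat.card H * Nat.card N := by
  have h : Nat.card ((H ⊔ N : Subgroup G) : Set G) ≤ _ :=
    (congrArg (fun s : Set G => Nat.card s) (Subgroup.mul_normal H N)).trans_le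
      (Set.natCard_mul_le (s := (H : Set G)) (t := (N : Set G)))
  exact h

variable [Finite G] {p : ℕ} [hp : Fact p.Prime]

theorem index_ne_two_of_isPGroup (hG : IsPGroup p G) (hp2 : p ≠ 2) (H : Subgroup G) :
    H.index ≠ 2 := by
  intro h
  obtain ⟨n, hn⟩ := hG.index H
  rw [h] at hn
  have h2 : 2 ∣ p := Nat.prime_two.dvd_of_dvd_pow (dvd_of_eq hn)
  exact hp2 ((Nat.prime_dvd_prime_iff_eq Nat.prime_two hp.out).1 h2).symm

/-- For odd `p`, a nonabelian `p`-group generated by two elements of order dividing `p` all of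
whose proper quotients are abelian is the group of order `p³` and exponent `p`. Each of its
subgroups of order `p²` contains a nonnormal subgroup of order `p`, and such subgroups chosen
for different subgroups of order `p²` are not conjugate. -/
theorem dPrime_le_of_minimal_not_comm (hG : IsPGroup p G) (hp2 : p ≠ 2) {a b : G}
    (ha : a ^ p = 1) (hb : b ^ p = 1) (hgen : Subgroup.closure {a, b} = ⊤)
    (hab : a * b ≠ b * a)
    (hquo : ∀ (N : Subgroup G) [N.Normal], N ≠ ⊥ → ∀ x y : G ⧸ N, x * y = y * x) :
    dPrime G ≤ 2 / 3 := by
  classical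
  have : Nontrivial G := ⟨⟨a * b, b * a, hab⟩⟩
  have hcomm : ∀ (N : Subgroup G) [N.Normal], N ≠ ⊥ → ∀ x y : G, x * y * x⁻¹ * y⁻¹ ∈ N := by
    intro N _ hN x y
    rw [← QuotientGroup.eq_one_iff]
    have := hquo N hN x y
    simp only [QuotientGroup.mk_mul, QuotientGroup.mk_inv, this]
    simp
  -- the center contains a subgroup `Z` of order `p`, the least nontrivial normal subgroup
  obtain ⟨Z, hZcard, hZcenter⟩ : ∃ Z : Subgroup G, Nat.card Z = p ∧ Z ≤ Subgroup.center G := by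
    have := hG.center_nontrivial
    have hd : p ∣ Nat.card (Subgroup.center G) :=
      ((hG.to_subgroup (Subgroup.center G)).card_eq_or_dvd).resolve_left
        Finite.one_lt_card.ne'
    obtain ⟨z, hz⟩ := exists_prime_orderOf_dvd_card' p hd
    refine ⟨Subgroup.zpowers z.1, ?_, (Subgroup.zpowers_le).2 z.2⟩
    rw [Nat.card_zpowers, Subgroup.orderOf_coe, hz]
  have hnormal_of_le_center : ∀ H : Subgroup G, H ≤ Subgroup.center G → H.Normal :=
    fun H hH => ⟨fun n hn g => by
      rwa [Subgroup.mem_center_iff.1 (hH hn) g, mul_inv_cancel_right]⟩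
  have hZn : Z.Normal := hnormal_of_le_center Z hZcenter
  have hZ0 : Z ≠ ⊥ := by
    rintro rfl
    rw [Subgroup.card_bot] at hZcard
    exact hp.out.one_lt.ne hZcard
  have hZp : Fact (Nat.card Z).Prime := ⟨hZcard ▸ hp.out⟩
  have hcZ := hcomm Z hZ0
  have hZle : ∀ (N : Subgroup G) [N.Normal], N ≠ ⊥ → Z ≤ N := by
    intro N _ hN
    rcases (N.subgroupOf Z).eq_bot_or_eq_top_of_prime_card with h | h
    · have : (⟨_, hcZ a b⟩ : Z) ∈ N.subgroupOf Z := hcomm N hN a b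
      rw [h, Subgroup.mem_bot, Subtype.ext_iff] at this
      refine absurd ?_ hab
      rwa [Subgroup.coe_one, mul_inv_eq_one, mul_inv_eq_iff_eq_mul] at this
    · exact Subgroup.subgroupOf_eq_top.1 h
  have hZcomm : ∀ c ∈ Z, ∀ g : G, Commute c g := fun c hc g =>
    (Subgroup.mem_center_iff.1 (hZcenter hc) g).symm
  have hnormal : ∀ H : Subgroup G, Z ≤ H → H.Normal := by
    refine fun H hH => ⟨fun n hn g => ?_⟩
    have := H.mul_mem (hH (hcZ g n)) hn
    rwa [inv_mul_cancel_right] at this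
  -- the exponent is `p`
  have hexp : ∀ x : G, x ^ p = 1 := by
    intro x
    have hx : x ∈ Subgroup.closure {a, b} := hgen ▸ Subgroup.mem_top x
    induction hx using Subgroup.closure_induction with
    | mem x hx => rcases hx with rfl | rfl <;> assumption
    | one => exact one_pow p
    | mul x y _ _ hx hy =>
      have hc := hcZ y⁻¹ x⁻¹
      have hcp : (y⁻¹ * x⁻¹ * y⁻¹⁻¹ * x⁻¹⁻¹) ^ p = 1 := by
        have := pow_card_eq_one' (x := (⟨_, hc⟩ : Z))
        rw [hZcard] at this
        exact congrArg Subtype.val this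
      rw [mul_pow_of_commutator (c := y⁻¹ * x⁻¹ * y⁻¹⁻¹ * x⁻¹⁻¹) (by group) (hZcomm _ hc x)
        (hZcomm _ hc y), hx, hy]
      -- `p` divides `p (p - 1) / 2` because `p` is odd
      obtain ⟨k, hk⟩ := hp.out.dvd_choose_self (k := 2) two_ne_zero
        (lt_of_le_of_ne hp.out.two_le (Ne.symm hp2))
      rw [hk, pow_mul, hcp, one_pow, mul_one, mul_one]
    | inv x _ hx => rw [inv_pow, hx, inv_one]
  have hord : ∀ x : G, x ≠ 1 → Nat.card (Subgroup.zpowers x) = p := fun x hx => by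
    rw [Nat.card_zpowers, orderOf_eq_prime (hexp x) hx]
  have hnot : ∀ x : G, x ∉ Z → ¬ (Subgroup.zpowers x).Normal := by
    intro x hx hn
    have hx1 : x ≠ 1 := fun h => hx (h ▸ Z.one_mem)
    have hle := hZle (Subgroup.zpowers x) (Subgroup.zpowers_ne_bot.2 hx1)
    have := Subgroup.eq_of_le_of_card_ge hle (by rw [hord x hx1, hZcard])
    exact hx (this ▸ Subgroup.mem_zpowers x)
  have haZ : a ∉ Z := fun h => hab (hZcomm a h b).eq
  have hbZ : b ∉ Z := fun h => hab (hZcomm b h a).eq.symm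
  have hgen' : ∀ H : Subgroup G, a ∈ H → b ∈ H → H = ⊤ := by
    intro H haH hbH
    rw [← top_le_iff, ← hgen, Subgroup.closure_le]
    rintro _ (rfl | rfl) <;> assumption
  have hcardG : Nat.card G ≤ p ^ 3 := by
    have hAn := hnormal (Subgroup.zpowers a ⊔ Z) le_sup_right
    have h1 := card_sup_le_of_normal (Subgroup.zpowers a) Z
    have h2 := card_sup_le_of_normal (Subgroup.zpowers b) (Subgroup.zpowers a ⊔ Z)
    rw [hgen' (Subgroup.zpowers b ⊔ (Subgroup.zpowers a ⊔ Z))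
      (le_sup_right (a := Subgroup.zpowers b)
        (le_sup_left (b := Z) (Subgroup.mem_zpowers a)))
      (le_sup_left (a := Subgroup.zpowers b) (Subgroup.mem_zpowers b)), Subgroup.card_top,
      hord b (fun h => hbZ (h ▸ Z.one_mem))] at h2
    rw [hord a (fun h => haZ (h ▸ Z.one_mem)), hZcard] at h1
    calc Nat.card G ≤ p * (p * p) := h2.trans (Nat.mul_le_mul_left p h1)
      _ = p ^ 3 := by ring
  have heq : ∀ H : Subgroup G, Z ≤ H → H ≠ ⊤ → ∀ x ∈ H, x ∉ Z → Subgroup.zpowers x ⊔ Z = H := by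
    intro H hZH hH x hxH hxZ
    refine Subgroup.eq_of_le_of_card_ge (sup_le ((Subgroup.zpowers_le).2 hxH) hZH) ?_
    have h1 : p ^ 2 ≤ Nat.card (Subgroup.zpowers x ⊔ Z : Subgroup G) := by
      obtain ⟨n, hn⟩ := IsPGroup.iff_card.1 (hG.to_subgroup (Subgroup.zpowers x ⊔ Z))
      rw [hn]
      refine Nat.pow_le_pow_right hp.out.pos ?_
      by_contra! hn2
      have hle : Nat.card (Subgroup.zpowers x ⊔ Z : Subgroup G) ≤ Nat.card Z := by
        rw [hn, hZcard]
        exact (Nat.pow_le_pow_right hp.out.pos (Nat.le_of_lt_succ hn2)).trans_eq (pow_one p)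
      have := Subgroup.eq_of_le_of_card_ge le_sup_right hle
      exact hxZ (this ▸ le_sup_left (b := Z) (Subgroup.mem_zpowers x))
    have h2 : Nat.card H * p ≤ p ^ 2 * p := by
      obtain ⟨n, hn⟩ := hG.index H
      have hn0 : n ≠ 0 := by
        rintro rfl
        exact hH (Subgroup.index_eq_one.1 (by rw [hn, pow_zero]))
      calc Nat.card H * p ≤ Nat.card H * H.index := by
            rw [hn]; exact Nat.mul_le_mul_left _ (Nat.le_self_pow hn0 p)
        _ = Nat.card G := H.card_mul_index
        _ ≤ p ^ 2 * p := hcardG.trans_eq (pow_succ p 2)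
    exact (Nat.le_of_mul_le_mul_right h2 hp.out.pos).trans h1
  -- the normal subgroups other than `⊥`, `Z` and `⊤`; these are the subgroups of order `p²`
  let 𝓗 : Finset (Subgroup G) :=
    (Set.toFinite {H : Subgroup G | H.Normal ∧ H ≠ ⊤ ∧ ¬ H ≤ Z}).toFinset
  have h𝓗 : ∀ {H}, H ∈ 𝓗 ↔ H.Normal ∧ H ≠ ⊤ ∧ ¬ H ≤ Z := by
    intro H; simp [𝓗]
  have hZ𝓗 : ∀ {H}, H ∈ 𝓗 → Z ≤ H := by
    intro H hH
    obtain ⟨h1, -, h3⟩ := h𝓗.1 hH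
    exact hZle H fun h => h3 (h ▸ bot_le)
  have hex : ∀ H : Subgroup G, ∃ x, H ∈ 𝓗 → x ∈ H ∧ x ∉ Z := by
    intro H
    by_cases hH : H ∈ 𝓗
    · obtain ⟨x, hx, hxZ⟩ := SetLike.not_le_iff_exists.1 (h𝓗.1 hH).2.2
      exact ⟨x, fun _ => ⟨hx, hxZ⟩⟩
    · exact ⟨1, fun h => absurd h hH⟩
  choose x hx using hex
  -- a conjugate of `x H` in `K` generates, together with `Z`, both `H` and `K`
  have hinj : ∀ H ∈ 𝓗, ∀ K ∈ 𝓗, ∀ g : G,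
      MulAut.conj g • Subgroup.zpowers (x K) = Subgroup.zpowers (x H) → H = K := by
    intro H hH K hK g hg
    have hKn := (h𝓗.1 hK).1
    have hxK : x H ∈ K := by
      have h1 : x H ∈ MulAut.conj g • Subgroup.zpowers (x K) :=
        hg ▸ Subgroup.mem_zpowers (x H)
      have h2 : MulAut.conj g • Subgroup.zpowers (x K) ≤ MulAut.conj g • K :=
        Subgroup.pointwise_smul_le_pointwise_smul_iff.2 ((Subgroup.zpowers_le).2 (hx K hK).1)
      rw [Subgroup.Normal.conj_smul_eq_self g K] at h2
      exact h2 h1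
    rw [← heq H (hZ𝓗 hH) (h𝓗.1 hH).2.1 (x H) (hx H hH).1 (hx H hH).2,
      ← heq K (hZ𝓗 hK) (h𝓗.1 hK).2.1 (x H) hxK (hx H hH).2]
  -- `⟨a⟩ Z` and `⟨b⟩ Z`
  have h𝓗2 : 2 ≤ 𝓗.card := by
    have hmem : ∀ u v : G, u ∉ Z → u * v ≠ v * u → Subgroup.zpowers u ⊔ Z ∈ 𝓗 := by
      intro u v hu huv
      have hle : Subgroup.zpowers u ⊔ Z ≤ Subgroup.centralizer {u} := by
        refine sup_le ((Subgroup.zpowers_le).2 ?_) fun c hc => ?_ <;>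
          rw [Subgroup.mem_centralizer_singleton_iff]
        exact (hZcomm c hc u).eq
      refine h𝓗.2 ⟨hnormal _ le_sup_right, fun h => huv ?_, fun h =>
        hu (h (le_sup_left (b := Z) (Subgroup.mem_zpowers u)))⟩
      rw [h] at hle
      exact (Subgroup.mem_centralizer_singleton_iff.1 (hle (Subgroup.mem_top v))).symm
    have hA := hmem a b haZ hab
    have hB := hmem b a hbZ (Ne.symm hab)
    refine Finset.one_lt_card.2 ⟨_, hA, _, hB, fun h => (h𝓗.1 hA).2.1 (hgen' _ ?_ ?_)⟩
    · exact le_sup_left (b := Z) (Subgroup.mem_zpowers a)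
    · rw [h]
      exact le_sup_left (b := Z) (Subgroup.mem_zpowers b)
  have hTcard : (𝓗.image fun H => Subgroup.zpowers (x H)).card = 𝓗.card :=
    Finset.card_image_of_injOn fun H hH K hK h =>
      hinj H hH K hK 1 (by rw [map_one, one_smul]; exact h.symm)
  refine dPrime_le_two_thirds (𝓗.image fun H => Subgroup.zpowers (x H)) ?_ ?_ ?_
  · intro _ hH'
    obtain ⟨H, hH, rfl⟩ := Finset.mem_image.1 hH'
    exact three_le_index_normalizer (hnot _ (hx H hH).2) (index_ne_two_of_isPGroup hG hp2 _)
  · intro _ hH' _ hK' g hg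
    obtain ⟨H, hH, rfl⟩ := Finset.mem_image.1 hH'
    obtain ⟨K, hK, rfl⟩ := Finset.mem_image.1 hK'
    rw [hinj H hH K hK g hg]
  · rw [hTcard]
    have : Nat.card {H : Subgroup G // H.Normal} ≤
        Nat.card (({⊥, Z, ⊤} ∪ 𝓗 : Finset (Subgroup G)) : Set (Subgroup G)) := by
      refine Nat.card_mono (Finset.finite_toSet _) fun H hH => ?_
      have hH : H.Normal := hH
      rw [Finset.mem_coe, Finset.mem_union, h𝓗]
      by_cases h0 : H = ⊥
      · simp [h0]
      by_cases h1 : H = ⊤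
      · simp [h1]
      by_cases h2 : H ≤ Z
      · simp [le_antisymm h2 (hZle H h0)]
      · exact Or.inr ⟨hH, h1, h2⟩
    rw [Nat.card_coe_set_eq, Set.ncard_coe_finset] at this
    have h3 := (Finset.card_union_le ({⊥, Z, ⊤} : Finset (Subgroup G)) 𝓗)
    have h4 : ({⊥, Z, ⊤} : Finset (Subgroup G)).card ≤ 3 := Finset.card_le_three
    omega

/-- Passing to a smallest nonabelian quotient reduces this to `dPrime_le_of_minimal_not_comm`. -/
theorem commute_of_two_thirds_lt_dStar (hG : IsPGroup p G) (hp2 : p ≠ 2)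
    (h : 2 / 3 < dStar G) {a b : G} (ha : a ^ p = 1) (hb : b ^ p = 1)
    (hgen : Subgroup.closure {a, b} = ⊤) : a * b = b * a := by
  induction hn : Nat.card G using Nat.strong_induction_on generalizing G with
  | _ n ih =>
    subst hn
    by_contra hab
    refine absurd (h.trans_le dStar_le_dPrime_self)
      (not_lt.2 (dPrime_le_of_minimal_not_comm hG hp2 ha hb hgen hab fun N _ hN => ?_))
    have hsurj := QuotientGroup.mk'_surjective N
    have hgenN : Subgroup.closure {(a : G ⧸ N), (b : G ⧸ N)} = ⊤ := by
      rw [← Subgroup.map_top_of_surjective _ hsurj, ← hgen, MonoidHom.map_closure,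
        Set.image_pair]
      rfl
    refine comm_of_closure_pair hgenN (ih _ ?_ (hG.to_quotient N)
      (h.trans_le (dStar_le_dStar_of_surjective _ hsurj)) ?_ ?_ hgenN rfl)
    · rw [N.card_eq_card_quotient_mul_card_subgroup]
      exact lt_mul_of_one_lt_right Nat.card_pos ((Subgroup.one_lt_card_iff_ne_bot N).2 hN)
    · rw [← QuotientGroup.mk_pow, ha, QuotientGroup.mk_one]
    · rw [← QuotientGroup.mk_pow, hb, QuotientGroup.mk_one]

end TwoGenerated

/-! ### Modularity of the subgroup lattice -/

section Modular

variable {G : Type*} [Group G]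

theorem le_normalizer_of_covBy [Group.IsNilpotent G] {D A : Subgroup G} (h : D ⋖ A) :
    A ≤ Subgroup.normalizer (D : Set G) := by
  have hco : IsCoatom (D.subgroupOf A) := by
    refine ⟨fun ht => h.lt.not_ge (Subgroup.subgroupOf_eq_top.1 ht), fun L hL => ?_⟩
    have h1 : D < L.map A.subtype := by
      rw [← Subgroup.map_subgroupOf_eq_of_le h.le]
      exact (Subgroup.map_lt_map_iff_of_injective A.subtype_injective).2 hL
    have h2 := (h.eq_or_eq h1.le (Subgroup.map_subtype_le L)).resolve_left h1.ne'
    refine Subgroup.map_injective A.subtype_injective ?_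
    rw [h2, ← MonoidHom.range_eq_map, Subgroup.range_subtype]
  have := Subgroup.NormalizerCondition.normal_of_coatom _
    (Group.normalizerCondition_of_isNilpotent (G := A)) hco
  exact (Subgroup.normal_subgroupOf_iff_le_normalizer h.le).1 this

theorem CovBy.subgroupOf {D A J : Subgroup G} (h : D ⋖ A) (hJ : A ≤ J) :
    D.subgroupOf J ⋖ A.subgroupOf J := by
  have hinj := J.subtype_injective
  refine ⟨?_, fun C h1 h2 => ?_⟩
  · rw [← Subgroup.map_lt_map_iff_of_injective hinj, Subgroup.map_subgroupOf_eq_of_le hJ,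
      Subgroup.map_subgroupOf_eq_of_le (h.le.trans hJ)]
    exact h.lt
  · rw [← Subgroup.map_lt_map_iff_of_injective hinj,
      Subgroup.map_subgroupOf_eq_of_le (h.le.trans hJ)] at h1
    rw [← Subgroup.map_lt_map_iff_of_injective hinj, Subgroup.map_subgroupOf_eq_of_le hJ] at h2
    exact h.2 h1 h2

theorem card_mul_relIndex_of_le {H K : Subgroup G} (h : H ≤ K) :
    Nat.card H * H.relIndex K = Nat.card K := by
  rw [← Subgroup.relIndex_bot_left, ← Subgroup.relIndex_bot_left]
  exact Subgroup.relIndex_mul_relIndex ⊥ H K bot_le h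

variable [Finite G]

/-- Semimodularity extends from covering pairs to all pairs, by downward induction on `D`. -/
theorem card_sup_mul_card_le_of_covBy
    (hcov : ∀ D A B : Subgroup G, D ⋖ A → D ⋖ B →
      Nat.card (A ⊔ B : Subgroup G) * Nat.card D ≤ Nat.card A * Nat.card B)
    (D A B : Subgroup G) (hDA : D ≤ A) (hDB : D ≤ B) :
    Nat.card (A ⊔ B : Subgroup G) * Nat.card D ≤ Nat.card A * Nat.card B := by
  induction D using WellFoundedGT.induction generalizing A B with
  | _ D ih =>
    rcases hDA.eq_or_lt with rfl | hA
    · rw [sup_eq_right.2 hDB, mul_comm]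
    rcases hDB.eq_or_lt with rfl | hB
    · rw [sup_eq_left.2 hDA]
    obtain ⟨A₁, hDA₁, hA₁⟩ := exists_covBy_le_of_lt hA
    obtain ⟨B₁, hDB₁, hB₁⟩ := exists_covBy_le_of_lt hB
    have h0 := hcov D A₁ B₁ hDA₁ hDB₁
    have h1 := ih A₁ hDA₁.lt A (A₁ ⊔ B₁) hA₁ le_sup_left
    have h2 := ih B₁ hDB₁.lt B (A₁ ⊔ B₁) hB₁ le_sup_right
    have h3 := ih (A₁ ⊔ B₁) (hDA₁.lt.trans_le le_sup_left) (A ⊔ (A₁ ⊔ B₁)) (B ⊔ (A₁ ⊔ B₁))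
      le_sup_right le_sup_right
    have hsup : A ⊔ (A₁ ⊔ B₁) ⊔ (B ⊔ (A₁ ⊔ B₁)) = A ⊔ B := by
      rw [← sup_sup_distrib_right, sup_eq_left]
      exact sup_le_sup hA₁ hB₁
    rw [hsup] at h3
    have ha : 0 < Nat.card A₁ := Nat.card_pos
    have hb : 0 < Nat.card B₁ := Nat.card_pos
    have he : 0 < Nat.card (A₁ ⊔ B₁ : Subgroup G) := Nat.card_pos
    generalize Nat.card (A₁ ⊔ B₁ : Subgroup G) = e at *
    generalize Nat.card (A ⊔ B : Subgroup G) = u at *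
    generalize Nat.card (A ⊔ (A₁ ⊔ B₁) : Subgroup G) = s at *
    generalize Nat.card (B ⊔ (A₁ ⊔ B₁) : Subgroup G) = t at *
    generalize Nat.card A₁ = α at *
    generalize Nat.card B₁ = β at *
    have h4 : u * (α * β) ≤ Nat.card A * Nat.card B * e := by
      refine Nat.le_of_mul_le_mul_right ?_ he
      calc u * (α * β) * e = u * e * (α * β) := by ring
        _ ≤ s * t * (α * β) := Nat.mul_le_mul_right _ h3
        _ = (s * α) * (t * β) := by ring
        _ ≤ (Nat.card A * e) * (Nat.card B * e) := Nat.mul_le_mul h1 h2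
        _ = Nat.card A * Nat.card B * e * e := by ring
    refine Nat.le_of_mul_le_mul_right ?_ he
    calc u * Nat.card D * e = u * (e * Nat.card D) := by ring
      _ ≤ u * (α * β) := Nat.mul_le_mul_left _ h0
      _ ≤ _ := h4

theorem card_mul_card_le_card_sup_mul_card_inf (A B : Subgroup G) :
    Nat.card A * Nat.card B ≤ Nat.card (A ⊔ B : Subgroup G) * Nat.card (A ⊓ B : Subgroup G) := by
  rw [← card_mul_relIndex_of_le (le_sup_left : A ≤ A ⊔ B),
    ← card_mul_relIndex_of_le (inf_le_right : A ⊓ B ≤ B), Subgroup.inf_relIndex_right]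
  have : A.relIndex B ≤ A.relIndex (A ⊔ B) :=
    Subgroup.relIndex_le_of_le_right le_sup_right Subgroup.index_ne_zero_of_finite
  calc _ ≤ Nat.card A * (Nat.card (A ⊓ B : Subgroup G) * A.relIndex (A ⊔ B)) := by gcongr
    _ = _ := by ring

/-- The two sides of the modular law have equal joins and meets with `y`; by the cardinality
inequality they have equal orders. -/
theorem isModularLattice_of_card_sup_mul_card_le
    (h : ∀ D A B : Subgroup G, D ≤ A → D ≤ B →
      Nat.card (A ⊔ B : Subgroup G) * Nat.card D ≤ Nat.card A * Nat.card B) :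
    IsModularLattice (Subgroup G) := by
  refine ⟨fun {x} y {z} hxz => ?_⟩
  have hle : x ⊔ y ⊓ z ≤ (x ⊔ y) ⊓ z := 
    le_inf (sup_le_sup_left inf_le_left x) (sup_le hxz inf_le_right)
  refine (Subgroup.eq_of_le_of_card_ge hle ?_).ge
  have h1 := card_mul_card_le_card_sup_mul_card_inf ((x ⊔ y) ⊓ z) y
  have h2 := h (y ⊓ z) (x ⊔ y ⊓ z) y le_sup_right inf_le_left
  have e1 : (x ⊔ y) ⊓ z ⊔ y = x ⊔ y :=
    le_antisymm (sup_le inf_le_left le_sup_right)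
      (sup_le (le_sup_of_le_left (le_inf le_sup_left hxz)) le_sup_right)
  have e2 : (x ⊔ y) ⊓ z ⊓ y = y ⊓ z := by
    rw [inf_right_comm, inf_eq_right.2 (le_sup_right : y ≤ x ⊔ y)]
  have e3 : x ⊔ y ⊓ z ⊔ y = x ⊔ y := by
    rw [sup_assoc, sup_eq_right.2 (inf_le_left : y ⊓ z ≤ y)]
  rw [e1, e2] at h1
  rw [e3] at h2
  exact Nat.le_of_mul_le_mul_right (h1.trans h2) Nat.card_pos

variable {p : ℕ} [hp : Fact p.Prime]

/-- In a finite `p`-group, a subgroup covering a normal subgroup `D` is generated by `D` and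
an element whose `p`-th power lies in `D`. -/
theorem exists_sup_zpowers_eq_of_covBy (hG : IsPGroup p G) {D A : Subgroup G} [D.Normal]
    (h : D ⋖ A) : ∃ a ∈ A, a ^ p ∈ D ∧ D ⊔ Subgroup.zpowers a = A := by
  have hnt : Nontrivial (A ⧸ D.subgroupOf A) := by
    rw [QuotientGroup.nontrivial_iff]
    exact fun ht => h.lt.not_ge (Subgroup.subgroupOf_eq_top.1 ht)
  have hd : p ∣ Nat.card (A ⧸ D.subgroupOf A) :=
    (((hG.to_subgroup A).to_quotient (D.subgroupOf A)).card_eq_or_dvd).resolve_left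
      Finite.one_lt_card.ne'
  obtain ⟨y, hy⟩ := exists_prime_orderOf_dvd_card' p hd
  obtain ⟨a, rfl⟩ := QuotientGroup.mk_surjective y
  have ha : a.1 ∉ D := by
    intro ha
    have : (a : A ⧸ D.subgroupOf A) = 1 := (QuotientGroup.eq_one_iff a).2 ha
    rw [this, orderOf_one] at hy
    exact hp.out.one_lt.ne hy
  refine ⟨a, a.2, ?_, ?_⟩
  · have := pow_orderOf_eq_one (a : A ⧸ D.subgroupOf A)
    rw [hy, ← QuotientGroup.mk_pow, QuotientGroup.eq_one_iff] at this
    exact this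
  · refine (h.eq_or_eq le_sup_left (sup_le h.le ((Subgroup.zpowers_le).2 a.2))).resolve_left
      fun he => ha ?_
    rw [← he]
    exact le_sup_right (a := D) (Subgroup.mem_zpowers a.1)

/-- The case of `card_sup_mul_card_le_of_two_thirds_lt_dStar` in which `A` and `B` generate. -/
theorem card_mul_card_le_of_sup_eq_top (hG : IsPGroup p G) (hp2 : p ≠ 2) (h : 2 / 3 < dStar G)
    {D A B : Subgroup G} (hDA : D ⋖ A) (hDB : D ⋖ B) (hAB : A ⊔ B = ⊤) :
    Nat.card G * Nat.card D ≤ Nat.card A * Nat.card B := by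
  have := hG.isNilpotent
  have hD : D.Normal := by
    rw [← Subgroup.normalizer_eq_top_iff, ← top_le_iff, ← hAB]
    exact sup_le (le_normalizer_of_covBy hDA) (le_normalizer_of_covBy hDB)
  obtain ⟨a, haA, hap, haD⟩ := exists_sup_zpowers_eq_of_covBy hG hDA
  obtain ⟨b, hbB, hbp, hbD⟩ := exists_sup_zpowers_eq_of_covBy hG hDB
  have hsurj := QuotientGroup.mk'_surjective D
  have hgen : Subgroup.closure {(a : G ⧸ D), (b : G ⧸ D)} = ⊤ := by
    refine Subgroup.comap_injective hsurj ?_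
    rw [Subgroup.comap_top, ← top_le_iff, ← hAB, ← haD, ← hbD]
    have hle : D ≤ (Subgroup.closure {(a : G ⧸ D), (b : G ⧸ D)}).comap (QuotientGroup.mk' D) := by
      conv_lhs => rw [← QuotientGroup.ker_mk' D]
      exact Subgroup.ker_le_comap _ _
    refine sup_le (sup_le hle ?_) (sup_le hle ?_) <;> rw [Subgroup.zpowers_le] <;>
      exact Subgroup.subset_closure (by simp)
  have hcomm : ∀ x y : G ⧸ D, x * y = y * x := by
    refine comm_of_closure_pair hgen (commute_of_two_thirds_lt_dStar (hG.to_quotient D) hp2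
      (h.trans_le (dStar_le_dStar_of_surjective _ hsurj)) ?_ ?_ hgen)
    · rwa [← QuotientGroup.mk_pow, QuotientGroup.eq_one_iff]
    · rwa [← QuotientGroup.mk_pow, QuotientGroup.eq_one_iff]
  have hA : A.Normal := by
    refine ⟨fun n hn g => ?_⟩
    have h1 : g * n * g⁻¹ * n⁻¹ ∈ D := by
      rw [← QuotientGroup.eq_one_iff]
      simp only [QuotientGroup.mk_mul, QuotientGroup.mk_inv, hcomm g n]
      simp
    have := A.mul_mem (hDA.le h1) hn
    rwa [inv_mul_cancel_right] at this
  have h1 : A.relIndex B ≤ D.relIndex B :=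
    Subgroup.relIndex_le_of_le_left hDA.le Subgroup.index_ne_zero_of_finite
  have h2 : Nat.card A * A.relIndex B = Nat.card G := by
    rw [← Subgroup.relIndex_sup_right, sup_comm, hAB, Subgroup.relIndex_top_right,
      Subgroup.card_mul_index]
  rw [← h2, ← card_mul_relIndex_of_le hDB.le]
  calc _ ≤ Nat.card A * D.relIndex B * Nat.card D := by gcongr
    _ = _ := by ring

theorem card_sup_mul_card_le_of_two_thirds_lt_dStar (hG : IsPGroup p G) (hp2 : p ≠ 2)
    (h : 2 / 3 < dStar G) {D A B : Subgroup G} (hDA : D ⋖ A) (hDB : D ⋖ B) :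
    Nat.card (A ⊔ B : Subgroup G) * Nat.card D ≤ Nat.card A * Nat.card B := by
  have hA : A ≤ A ⊔ B := le_sup_left
  have hB : B ≤ A ⊔ B := le_sup_right
  have key := card_mul_card_le_of_sup_eq_top (hG.to_subgroup (A ⊔ B)) hp2
    (h.trans_le (dStar_le_dStar_of_injective _ (A ⊔ B).subtype_injective))
    (hDA.subgroupOf hA) (hDB.subgroupOf hB)
    (by rw [← Subgroup.subgroupOf_sup hA hB, Subgroup.subgroupOf_self])
  rwa [Nat.card_congr (Subgroup.subgroupOfEquivOfLe hA).toEquiv,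
    Nat.card_congr (Subgroup.subgroupOfEquivOfLe hB).toEquiv,
    Nat.card_congr (Subgroup.subgroupOfEquivOfLe (hDA.le.trans hA)).toEquiv] at key

theorem isModularLattice_of_two_thirds_lt_dStar (hG : IsPGroup p G) (hp2 : p ≠ 2)
    (h : 2 / 3 < dStar G) : IsModularLattice (Subgroup G) :=
  isModularLattice_of_card_sup_mul_card_le (card_sup_mul_card_le_of_covBy fun _ _ _ hA hB =>
    card_sup_mul_card_le_of_two_thirds_lt_dStar hG hp2 h hA hB)

end Modular

/-! ### The decomposition into Sylow subgroups -/

theorem exists_mulEquiv_pi_sylow (G : Type*) [Group G] [Finite G] [Group.IsNilpotent G] :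
    ∃ (k : ℕ) (p : Fin k → ℕ) (P : Fin k → Subgroup G), Function.Injective p ∧
      (∀ i, (p i).Prime ∧ p i ∣ Nat.card G ∧ IsPGroup (p i) (P i)) ∧
      Nonempty (G ≃* (∀ i, P i)) := by
  let ι := (Nat.card G).primeFactors
  let e : Fin ι.card ≃ ι := ι.equivFin.symm
  let S : ∀ q : ι, Sylow q G := fun q => default
  have hprime : ∀ q : ι, Fact (q : ℕ).Prime := fun q => ⟨Nat.prime_of_mem_primeFactors q.2⟩
  have hn : ∀ {q : ℕ} [Fact q.Prime] (P : Sylow q G), P.Normal := inferInstance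
  let u : ∀ q : ι, Unique (Sylow q G) := fun q => Sylow.unique_of_normal (S q) (hn (S q))
  refine ⟨ι.card, fun i => e i, fun i => S (e i), Subtype.val_injective.comp e.injective,
    fun i => ⟨(hprime _).out, Nat.dvd_of_mem_primeFactors (e i).2, (S (e i)).isPGroup'⟩, ⟨?_⟩⟩
  have f1 : G ≃* ∀ q : ι, ∀ P : Sylow q G, P := (Sylow.directProductOfNormal hn).symm
  have f2 : (∀ q : ι, ∀ P : Sylow q G, P) ≃* ∀ q : ι, (S q : Subgroup G) :=
    MulEquiv.piCongrRight fun q =>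
      letI := u q
      (MulEquiv.piUnique (fun P : Sylow q G => P)).trans
        (MulEquiv.subgroupCongr (congrArg _ (Subsingleton.elim _ _)))
  have f3 : (∀ q : ι, (S q : Subgroup G)) ≃* ∀ i, (S (e i) : Subgroup G) :=
    { Equiv.piCongrLeft' (fun q : ι => (S q : Subgroup G)) e.symm with
      map_mul' := fun _ _ => rfl }
  exact f1.trans (f2.trans f3)

theorem theoremB (G : Type*) [Group G] [Finite G] :
    (dStar (Equiv.Perm (Fin 3)) = 2 / 3 ∧ dPrime (Equiv.Perm (Fin 3)) = 2 / 3) ∧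
    (2 / 3 < dStar G →
      Group.IsNilpotent G ∧
      (¬ 2 ∣ Nat.card G →
        ∃ (k : ℕ) (p : Fin k → ℕ) (P : Fin k → Subgroup G),
          Function.Injective p ∧
          (∀ i, IsModularPGroup (p i) (P i)) ∧
          Nonempty (G ≃* (∀ i, P i)))) := by
  refine ⟨⟨dStar_perm, dPrime_perm⟩, fun h => ?_⟩
  have hnil := isNilpotent_of_two_thirds_lt_dStar h
  refine ⟨hnil, fun hodd => ?_⟩
  obtain ⟨k, p, P, hinj, hP, he⟩ := exists_mulEquiv_pi_sylow G
  refine ⟨k, p, P, hinj, fun i => ?_, he⟩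
  obtain ⟨hprime, hdvd, hPi⟩ := hP i
  have := Fact.mk hprime
  exact ⟨hprime, hPi, isModularLattice_of_two_thirds_lt_dStar hPi (fun h2 => hodd (h2 ▸ hdvd))
    (h.trans_le (dStar_le_dStar_of_injective _ (P i).subtype_injective))⟩
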